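/- Let $F_N$ be the free group of rank $N\ge 2$. Unprojectivised Outer space $\mathrm{cv}_N$ consists of the free, minimal, discrete, isometric actions of $F_N$ on $\mathbb R$-trees; a point of Outer space $\mathrm{CV}_N$ is such a tree of covolume one, equivalently a finite metric graph of total length one, with all vertices of valence at least three, together with an identification of its fundamental group with $F_N$ (up to conjugation). The simplex $\Sigma$ (with missing faces) of $\mathrm{CV}_N$ given by a marked graph $\Gamma$ consists of all assignments of lengths $\ell\ge 0$ to the edges of $\Gamma$ of total length one for which the edges of length zero form a forest; such an $\ell$ represents the marked metric graph obtained by collapsing the edges of length zero. For $T_0\in\Sigma$, whose tree (universal cover) is also denoted $T_0$, and $T\in\mathrm{cv}_N$, a difference of markings $f:T_0\to T$ is an $F_N$-equivariant map that is linear, with some constant slope, on every edge; $\sigma(f)$ is its largest slope, $d(T_0,T)=\inf_f\log\sigma(f)$, and $f$ is optimal if $\log\sigma(f)=d(T_0,T)$. The tension graph of $f$ is the union of the edges of $T_0/F_N$ on which the slope is $\sigma(f)$. Two directions in the tension graph at a vertex of $T_0/F_N$ are equivalent (in the same gate) if $f$ takes lifts of them at a common vertex of $T_0$ to the same direction of $T$.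 A train track structure on a graph is an equivalence relation on the directions at each vertex with at least two classes at every vertex; a loop is legal if it never passes (also at its base point) through a pair of equivalent directions; the structure is recurrent if there is a legal loop crossing every edge. An optimal map $f$ induces a train track structure on $T_0/F_N$ if its tension graph is all of $T_0/F_N$ and the above equivalence of directions is a train track structure. Let $T\in\mathrm{CV}_N$ (or, more generally, $T\in\mathrm{cv}_N$), and let $\Sigma$ be a fixed simplex of $\mathrm{CV}_N$. Then there is a point $T_0\in\Sigma$ that minimises the function $Y\mapsto d(Y,T)$ on $\Sigma$. For every such minimising point $T_0$, every optimal map $f:T_0\to T$ induces a train track structure on $T_0/F_N$, and this train track structure is recurrent. -/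

import Mathlib

universe u v w

namespace OuterSpace

/-! ## Trees: the points of unprojectivised Outer space -/

/-- An `ℝ`-tree: a non-empty geodesic metric space that is `0`-hyperbolic (four-point condition). -/
structure IsRTree (X : Type u) [MetricSpace X] : Prop where
  nonempty : Nonempty X
  geodesic : ∀ x y : X, ∃ γ : ℝ → X, γ 0 = x ∧ γ (dist x y) = y ∧
    ∀ s ∈ Set.Icc 0 (dist x y), ∀ t ∈ Set.Icc 0 (dist x y), dist (γ s) (γ t) = |s - t|
  four_point : ∀ x y z w : X,
    dist x y + dist z w ≤ max (dist x z + dist y w) (dist x w + dist y z)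

/-- A (non-empty) subtree of an `ℝ`-tree: a non-empty subset containing the geodesic segment
between any two of its points. -/
def IsSubtree {X : Type u} [MetricSpace X] (S : Set X) : Prop :=
  S.Nonempty ∧ ∀ x ∈ S, ∀ y ∈ S, ∀ z, dist x z + dist z y = dist x y → z ∈ S

/-- A point of unprojectivised Outer space `cv_N`: a free, minimal, discrete, isometric action of
the free group `F_N` on an `ℝ`-tree. (The points of `CV_N` are those normalised to covolume one;
no normalisation is imposed here.) -/
structure FNTree (N : ℕ) where
  carrier : Type u
  [metric : MetricSpace carrier]
  [action : MulAction (FreeGroup (Fin N)) carrier]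
  isRTree : IsRTree carrier
  isometric : ∀ (g : FreeGroup (Fin N)) (x y : carrier), dist (g • x) (g • y) = dist x y
  free : ∀ (g : FreeGroup (Fin N)) (x : carrier), g • x = x → g = 1
  discrete : ∀ x : carrier, IsDiscrete (MulAction.orbit (FreeGroup (Fin N)) x)
  minimal : ∀ S : Set carrier, IsSubtree S →
    (∀ (g : FreeGroup (Fin N)), ∀ x ∈ S, g • x ∈ S) → S = Set.univ

attribute [instance] FNTree.metric FNTree.action

/-! ## Graphs and train track structures -/

/-- A graph, given by vertices, oriented edges, the origin of each oriented edge, and the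
fixed-point free involution reversing orientation. An oriented edge `e` is also thought of as a
direction (half-edge) at its origin `src e`. -/
structure Graph where
  Vert : Type u
  Edge : Type v
  src : Edge → Vert
  rev : Edge → Edge
  rev_rev : ∀ e, rev (rev e) = e
  rev_ne : ∀ e, rev e ≠ e

/-- A train track structure: an equivalence relation on the directions at each vertex (whose
classes are the gates), with at least two gates at every vertex. -/
structure TrainTrack (Γ : Graph.{u, v}) where
  rel : Γ.Edge → Γ.Edge → Prop
  src_eq : ∀ a b, rel a b → Γ.src a = Γ.src b
  equivalence : Equivalence rel
  two_gates : ∀ x : Γ.Vert, ∃ a b, Γ.src a = x ∧ Γ.src b = x ∧ ¬ rel a b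

/-- The cyclic sequence of oriented edges `c 0, c 1, …, c n` is a loop all of whose turns,
including the one at the base point, are legal. (Addition in `Fin (n + 1)` is cyclic.) -/
def TrainTrack.IsLegalLoop {Γ : Graph.{u, v}} (τ : TrainTrack Γ) {n : ℕ}
    (c : Fin (n + 1) → Γ.Edge) : Prop :=
  ∀ i, Γ.src (c (i + 1)) = Γ.src (Γ.rev (c i)) ∧ ¬ τ.rel (Γ.rev (c i)) (c (i + 1))

/-- A train track structure is recurrent if there is a legal loop crossing every edge (in at least
one of the two directions). -/
def TrainTrack.IsRecurrent {Γ : Graph.{u, v}} (τ : TrainTrack Γ) : Prop :=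
  ∃ (n : ℕ) (c : Fin (n + 1) → Γ.Edge), τ.IsLegalLoop c ∧ ∀ e, ∃ i, c i = e ∨ c i = Γ.rev e

/-! ## Marked graphs and the simplices of Outer space -/

/-- A marked graph of rank `N`: a finite connected graph all of whose vertices have valence at
least three, with an identification of its fundamental group with `F_N` up to conjugation. It is
given by its universal cover, a simplicial tree with a free action of `F_N`; the graph is the
quotient. -/
structure MarkedGraph (N : ℕ) where
  V : Type u
  [action : MulAction (FreeGroup (Fin N)) V]
  tree : SimpleGraph V
  isTree : tree.IsTree
  smul_adj : ∀ (g : FreeGroup (Fin N)) {x y : V}, tree.Adj x y → tree.Adj (g • x) (g • y)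
  free : ∀ (g : FreeGroup (Fin N)) (x : V), g • x = x → g = 1
  finite_orbits : Finite (MulAction.orbitRel.Quotient (FreeGroup (Fin N)) V)
  finite_neighbors : ∀ x, (tree.neighborSet x).Finite
  three_le_valence : ∀ x, 3 ≤ (tree.neighborSet x).ncard

attribute [instance] MarkedGraph.action

namespace MarkedGraph

variable {N : ℕ} (Γ : MarkedGraph.{u} N)

/-- The action of `F_N` on the oriented edges of the universal cover. -/
instance : MulAction (FreeGroup (Fin N)) Γ.tree.Dart where
  smul g d := ⟨(g • d.fst, g • d.snd), Γ.smul_adj g d.adj⟩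
  one_smul d := SimpleGraph.Dart.ext _ _ (Prod.ext (one_smul _ d.fst) (one_smul _ d.snd))
  mul_smul g h d := SimpleGraph.Dart.ext _ _
    (Prod.ext (mul_smul g h d.fst) (mul_smul g h d.snd))

/-- The oriented edges of the (finite) marked graph. -/
abbrev OEdge : Type u := MulAction.orbitRel.Quotient (FreeGroup (Fin N)) Γ.tree.Dart

/-- The oriented edge of the marked graph covered by an oriented edge of the tree. -/
def proj (d : Γ.tree.Dart) : Γ.OEdge := Quotient.mk _ d

theorem proj_smul (g : FreeGroup (Fin N)) (d : Γ.tree.Dart) : Γ.proj (g • d) = Γ.proj d :=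
  Quotient.sound ⟨g, rfl⟩

theorem proj_eq_iff {d d' : Γ.tree.Dart} :
    Γ.proj d = Γ.proj d' ↔ ∃ g : FreeGroup (Fin N), g • d' = d :=
  ⟨fun h => Quotient.exact h, fun ⟨g, hg⟩ => hg ▸ Γ.proj_smul g d'⟩

/-- Reversal of orientation on the oriented edges of the marked graph. -/
def revEdge : Γ.OEdge → Γ.OEdge :=
  Quotient.map SimpleGraph.Dart.symm (by
    rintro a b ⟨g, hg⟩
    refine ⟨g, ?_⟩
    subst hg
    rfl)

theorem revEdge_proj (d : Γ.tree.Dart) : Γ.revEdge (Γ.proj d) = Γ.proj d.symm := rfl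

theorem revEdge_revEdge (e : Γ.OEdge) : Γ.revEdge (Γ.revEdge e) = e := by
  induction e using Quotient.inductionOn with
  | _ d => exact congrArg Γ.proj d.symm_symm

theorem revEdge_ne (e : Γ.OEdge) : Γ.revEdge e ≠ e := by
  induction e using Quotient.inductionOn with
  | _ d =>
    intro h
    obtain ⟨g, hg⟩ := Γ.proj_eq_iff.1 h
    have h1 : g • d.fst = d.snd := congrArg (fun x : Γ.tree.Dart => x.fst) hg
    have h2 : g • d.snd = d.fst := congrArg (fun x : Γ.tree.Dart => x.snd) hg
    have h3 : g ^ 2 = 1 := Γ.free _ d.fst (by rw [pow_two, mul_smul, h1, h2])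
    have h4 : g = 1 := (pow_eq_one_iff_left two_ne_zero).1 h3
    rw [h4, one_smul] at h1
    exact d.adj.ne h1

instance : Finite Γ.OEdge := by
  have := Γ.finite_orbits
  have : ∀ x, Finite (Γ.tree.neighborSet x) := fun x => Γ.finite_neighbors x
  let F : (Σ q : MulAction.orbitRel.Quotient (FreeGroup (Fin N)) Γ.V,
      Γ.tree.neighborSet (Quotient.out q)) → Γ.OEdge := fun p => Γ.proj ⟨(_, p.2.1), p.2.2⟩
  refine Finite.of_surjective F fun e => ?_
  induction e using Quotient.inductionOn with
  | _ d =>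
    obtain ⟨g, hg⟩ := Quotient.exact
      (Quotient.out_eq (Quotient.mk (MulAction.orbitRel (FreeGroup (Fin N)) Γ.V) d.fst))
    have hadj := Γ.smul_adj g d.adj
    have hg' : g • d.fst = Quotient.out
      (Quotient.mk (MulAction.orbitRel (FreeGroup (Fin N)) Γ.V) d.fst) := hg
    rw [hg'] at hadj
    refine ⟨⟨_, ⟨g • d.snd, hadj⟩⟩, ?_⟩
    refine Γ.proj_eq_iff.2 ⟨g, ?_⟩
    exact SimpleGraph.Dart.ext _ _ (Prod.ext hg' rfl)

/-- The edges of the universal cover on which a symmetric function on the edges of the marked graph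
vanishes, as a subgraph of the universal cover. -/
def zeroGraph (len : Γ.OEdge → ℝ) (hlen : ∀ e, len (Γ.revEdge e) = len e) : SimpleGraph Γ.V where
  Adj x y := ∃ h : Γ.tree.Adj x y, len (Γ.proj ⟨(x, y), h⟩) = 0
  symm := ⟨fun x y ⟨h, h0⟩ => ⟨h.symm, by
    rw [← h0, ← hlen]
    rfl⟩⟩
  loopless := ⟨fun x ⟨h, _⟩ => h.ne rfl⟩

/-- A point of the simplex (with missing faces) of `CV_N` determined by a marked graph: an
assignment of lengths to the edges, of total length one. The faces are included as far as they
belong to `CV_N`: lengths may vanish, provided that the edges of length zero form a forest, i.e.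
no non-trivial element of the fundamental group is carried by them; the corresponding marked metric
graph is then obtained by collapsing the edges of length zero. -/
structure Simplex where
  len : Γ.OEdge → ℝ
  len_rev : ∀ e, len (Γ.revEdge e) = len e
  len_nonneg : ∀ e, 0 ≤ len e
  /-- every edge appears with both orientations in the sum -/
  volume : (∑ᶠ e, len e) / 2 = 1
  forest : ∀ (g : FreeGroup (Fin N)) (x : Γ.V),
    (Γ.zeroGraph len len_rev).Reachable x (g • x) → g = 1

end MarkedGraph

namespace MarkedGraph.Simplex

variable {N : ℕ} {Γ : MarkedGraph.{u} N} (S : Γ.Simplex)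

/-- Two vertices of the universal cover of the marked graph represent the same vertex of the metric
tree `T₀` given by a point of the simplex (`T₀` is obtained by collapsing the edges of length
zero). -/
def SameVertex (x y : Γ.V) : Prop := (Γ.zeroGraph S.len S.len_rev).Reachable x y

theorem sameVertex_smul (g : FreeGroup (Fin N)) {x y : Γ.V} (h : S.SameVertex x y) :
    S.SameVertex (g • x) (g • y) := by
  refine h.map (G' := Γ.zeroGraph S.len S.len_rev) ⟨fun z => g • z, ?_⟩
  rintro a b ⟨hab, h0⟩
  refine ⟨Γ.smul_adj g hab, ?_⟩
  rw [← h0]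
  exact congrArg S.len (Γ.proj_smul g ⟨(a, b), hab⟩)

/-- Two vertices of the universal cover of the marked graph represent the same vertex of
`T₀ / F_N`. -/
def vertSetoid : Setoid Γ.V where
  r x y := ∃ g : FreeGroup (Fin N), S.SameVertex x (g • y)
  iseqv :=
    { refl := fun x => ⟨1, by rw [one_smul]; exact SimpleGraph.Reachable.refl x⟩
      symm := fun {x y} ⟨g, h⟩ => ⟨g⁻¹, by
        have := S.sameVertex_smul g⁻¹ h
        rw [inv_smul_smul] at this
        exact this.symm⟩
      trans := fun {x y z} ⟨g, h⟩ ⟨k, h'⟩ => ⟨g * k, by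
        have := S.sameVertex_smul g h'
        rw [← mul_smul] at this
        exact h.trans this⟩ }

/-- The finite graph `T₀ / F_N`, where `T₀` is the metric tree given by a point of the simplex: its
oriented edges are those of the marked graph that have positive length, and its vertices are those
of the marked graph, identified when they are joined by edges of length zero. -/
def quotientGraph : Graph.{u, u} where
  Vert := Quotient S.vertSetoid
  Edge := {e : Γ.OEdge // 0 < S.len e}
  src e := Quotient.lift (fun d : Γ.tree.Dart => (Quotient.mk S.vertSetoid d.fst)) (by
    rintro a b ⟨g, rfl⟩
    exact Quotient.sound ⟨g, SimpleGraph.Reachable.refl _⟩) e.1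
  rev e := ⟨Γ.revEdge e.1, by rw [S.len_rev]; exact e.2⟩
  rev_rev e := Subtype.ext (Γ.revEdge_revEdge e.1)
  rev_ne e h := Γ.revEdge_ne e.1 (congrArg Subtype.val h)

/-- A difference of markings `T₀ → T`, where `T₀` is the metric tree given by a point of a simplex:
an `F_N`-equivariant map that is linear (of constant slope, onto a geodesic segment or a point) on
every edge of `T₀`. Such a map is the same as an arbitrary equivariant map on the vertices of `T₀`,
i.e. an equivariant map on the vertices of the universal cover of the marked graph that takes the
same value at the two endpoints of each edge of length zero. -/
structure DiffOfMarkings (T : FNTree.{w} N) where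
  toFun : Γ.V → T.carrier
  map_smul : ∀ (g : FreeGroup (Fin N)) (x : Γ.V), toFun (g • x) = g • toFun x
  map_zero : ∀ d : Γ.tree.Dart, S.len (Γ.proj d) = 0 → toFun d.fst = toFun d.snd

namespace DiffOfMarkings

variable {S} {T : FNTree.{w} N} (f : S.DiffOfMarkings T)

/-- The slope of a difference of markings on an edge of `T₀` (on the edges of the universal cover
that are collapsed in `T₀`, which play no role, the value of this expression is zero). -/
noncomputable def slope (d : Γ.tree.Dart) : ℝ :=
  dist (f.toFun d.fst) (f.toFun d.snd) / S.len (Γ.proj d)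

/-- The largest slope `σ(f)`, i.e. the Lipschitz constant of `f`. -/
noncomputable def maxSlope : ℝ := ⨆ d, f.slope d

end DiffOfMarkings

/-- The Lipschitz distance `d(T₀, T) = inf log σ(f)`. -/
noncomputable def lipDist (T : FNTree.{w} N) : ℝ :=
  ⨅ f : S.DiffOfMarkings T, Real.log f.maxSlope

/-- The point `S` of its simplex minimises the Lipschitz distance to `T`. -/
def IsMinimizer (T : FNTree.{w} N) : Prop := ∀ S' : Γ.Simplex, S.lipDist T ≤ S'.lipDist T

namespace DiffOfMarkings

variable {S} {T : FNTree.{w} N} (f : S.DiffOfMarkings T)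

/-- An optimal map: a difference of markings realising the Lipschitz distance. -/
def IsOptimal : Prop := S.lipDist T = Real.log f.maxSlope

/-- The tension graph `Δ_f`, a set of edges of `T₀ / F_N`: the edges on which the slope of `f` is
maximal. -/
def tensionGraph : Set S.quotientGraph.Edge :=
  {e | ∀ d : Γ.tree.Dart, Γ.proj d = e.1 → f.slope d = f.maxSlope}

/-- Two directions at the same vertex of `T₀ / F_N` are in the same gate when `f` takes both to the
same direction in `T`: for lifts `d`, `d'` of them at the same vertex of `T₀`, mapped to `p`, the
segments from `p` to the images of the other endpoints of `d`, `d'` overlap in a non-degenerate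
segment starting at `p`, i.e. their other endpoints have positive Gromov product based at `p`. -/
def SameGate (a b : S.quotientGraph.Edge) : Prop :=
  ∃ d d' : Γ.tree.Dart, Γ.proj d = a.1 ∧ Γ.proj d' = b.1 ∧ S.SameVertex d.fst d'.fst ∧
    dist (f.toFun d.snd) (f.toFun d'.snd) <
      dist (f.toFun d.fst) (f.toFun d.snd) + dist (f.toFun d'.fst) (f.toFun d'.snd)

/-- `f` induces the train track structure `τ` on all of `T₀ / F_N`: the tension graph of `f` is all
of `T₀ / F_N`, and the gates of `τ` are those of `f`. -/
def Induces (τ : TrainTrack S.quotientGraph) : Prop :=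
  f.tensionGraph = Set.univ ∧ ∀ a b, τ.rel a b ↔ f.SameGate a b

end DiffOfMarkings

end MarkedGraph.Simplex

end OuterSpace

/-!
Write `v` for the infimum, over all equivariant maps from the vertices of the universal cover of
`Γ` to `T`, of the volume: the sum of the lengths of the images of the edges of `Γ`. A point of
the simplex has volume one, so the largest slope of a difference of markings, being at least the
average slope, is at least the volume of the underlying map (`volume_le_maxSlope`). Conversely, an
equivariant map has constant slope, equal to its volume, on the metric graph whose lengths are
those of the images of edges, rescaled (`EquivariantMap.diffOfMarkings`); that the edges of length
zero form a forest is automatic, as `F_N` acts freely on `T`. So the distance from the simplex to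
`T` is `log v`.

A minimising point is found as a limit of the metric graphs of a sequence of maps whose volumes
tend to `v`. Non-trivial elements have positive translation length in `T`, so none can be carried
by edges whose length tends to zero: the limit is in the simplex. The maps are modified slightly
so as to be constant on the edges collapsed in the limit (`lipDist_le_of_tendsto`); no limit of
the maps is needed.

At a minimising point, an optimal map `f` has largest slope `v`, which then is also its volume and
its average slope. Hence its tension graph is everything, and `f` minimises the volume. Moving the
image of a vertex by a small `ε` into a gate shortens each edge once for every end in the gate and
lengthens it at most once for every other end at the vertex. As the volume cannot decrease, each
gate contains at most half of the directions at its vertex (`two_mul_card_gate_le`). In particular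
there are at least two gates at every vertex.

This balance also gives recurrence. By Hall's theorem the directions at each vertex can be
permuted such that every direction is moved to another gate. Entering a vertex along one direction
and leaving it along its image decomposes the graph into legal loops. Two legal loops that meet at
a vertex can be merged to a single legal loop, after reversing one of them if need be, because of
the two ways to recombine their legal turns at least one is legal (`legalPath_of_meet`). As the
graph is connected, all the loops merge into one that crosses every edge.
-/

namespace OuterSpace

/-! ### Translation lengths -/

namespace IsRTree

variable {X : Type u} [MetricSpace X]

theorem exists_dist_eq (hX : IsRTree X) (x y : X) {r : ℝ} (h0 : 0 ≤ r) (h1 : r ≤ dist x y) :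
    ∃ z, dist x z = r ∧ dist z y = dist x y - r := by
  obtain ⟨γ, h0', h1', h⟩ := hX.geodesic x y
  refine ⟨γ r, ?_, ?_⟩
  · have := h 0 ⟨le_rfl, dist_nonneg⟩ r ⟨h0, h1⟩
    rwa [h0', zero_sub, abs_neg, abs_of_nonneg h0] at this
  · have := h r ⟨h0, h1⟩ (dist x y) ⟨dist_nonneg, le_rfl⟩
    rwa [h1', abs_sub_comm, abs_of_nonneg (sub_nonneg.2 h1)] at this

/-- If an isometry does not move `x` further away under its square than under itself, then it fixes
the midpoint of `x` and its image. -/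
theorem exists_fixed_of_dist_le (hX : IsRTree X) {φ : X → X}
    (hφ : ∀ x y, dist (φ x) (φ y) = dist x y) {x : X}
    (h : dist x (φ (φ x)) ≤ dist x (φ x)) : ∃ m, φ m = m := by
  obtain ⟨m, hm1, hm2⟩ := hX.exists_dist_eq x (φ x) (r := dist x (φ x) / 2)
    (by positivity) (by linarith [dist_nonneg (x := x) (y := φ x)])
  refine ⟨m, ?_⟩
  have e1 := hφ x m
  have e2 := hφ m (φ x)
  have e3 := hφ x (φ x)
  have k1 := hX.four_point (φ m) x (φ x) (φ (φ x))
  have k2 := hX.four_point m (φ m) x (φ x)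
  have c1 := dist_comm (φ m) (φ x)
  have c2 := dist_comm m x
  have c3 := dist_comm (φ m) x
  have hx : dist (φ m) x ≤ dist x (φ x) / 2 := by
    rcases le_max_iff.1 k1 with h | h <;> linarith
  refine (dist_le_zero.1 ?_).symm
  rcases le_max_iff.1 k2 with h | h <;> linarith

end IsRTree

namespace FNTree

variable {N : ℕ} (T : FNTree.{w} N)

/-- Once `g²` moves `x` further than `g` does, the displacement of `x` under the powers of `g` is an
arithmetic progression: of the three sums of opposite distances among `x`, `gx`, `gⁿx`, `gⁿ⁺¹x`, the
two largest agree. -/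
theorem dist_pow_smul (g : FreeGroup (Fin N)) (x : T.carrier)
    (h : dist x (g • x) < dist x (g ^ 2 • x)) (n : ℕ) :
    dist x (g ^ (n + 1) • x) =
      dist x (g • x) + n * (dist x (g ^ 2 • x) - dist x (g • x)) := by
  have key : ∀ n : ℕ, dist x (g ^ (n + 1) • x) =
      dist x (g • x) + n * (dist x (g ^ 2 • x) - dist x (g • x)) ∧
      dist x (g ^ (n + 2) • x) =
      dist x (g • x) + (n + 1) * (dist x (g ^ 2 • x) - dist x (g • x)) := by
    intro n
    induction n with
    | zero => simp
    | succ n ih =>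
      obtain ⟨i1, i2⟩ := ih
      refine ⟨by push_cast; exact i2, ?_⟩
      have s : ∀ k : ℕ, dist (g • x) (g ^ (k + 1) • x) = dist x (g ^ k • x) := fun k => by
        rw [pow_succ', mul_smul, T.isometric]
      have s1 := s (n + 2)
      have s2 := s (n + 1)
      have s3 : dist (g ^ (n + 2) • x) (g ^ (n + 3) • x) = dist x (g • x) := by
        rw [pow_succ g (n + 2), mul_smul, T.isometric]
      have k1 := T.isRTree.four_point x (g ^ (n + 2) • x) (g • x) (g ^ (n + 3) • x)
      have k2 := T.isRTree.four_point x (g ^ (n + 3) • x) (g • x) (g ^ (n + 2) • x)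
      have hn : (0 : ℝ) ≤ n * (dist x (g ^ 2 • x) - dist x (g • x)) :=
        mul_nonneg n.cast_nonneg (by linarith)
      have c1 := dist_comm (g ^ (n + 2) • x) (g • x)
      have c2 := dist_comm (g ^ (n + 3) • x) (g • x)
      have c3 := dist_comm (g ^ (n + 2) • x) (g ^ (n + 3) • x)
      push_cast
      rcases le_max_iff.1 k1 with k1 | k1 <;> rcases le_max_iff.1 k2 with k2 | k2 <;> linarith
  exact (key n).1

/-- A non-trivial element has positive translation length. -/
theorem exists_pos_le_dist_smul {g : FreeGroup (Fin N)} (hg : g ≠ 1) :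
    ∃ c > 0, ∀ y : T.carrier, c ≤ dist y (g • y) := by
  obtain ⟨x⟩ := T.isRTree.nonempty
  have h : dist x (g • x) < dist x (g ^ 2 • x) := by
    by_contra! h
    rw [pow_two, mul_smul] at h
    obtain ⟨m, hm⟩ := T.isRTree.exists_fixed_of_dist_le (T.isometric g) h
    exact hg (T.free g m hm)
  refine ⟨dist x (g ^ 2 • x) - dist x (g • x), by linarith, fun y => ?_⟩
  by_contra! hy
  have hn : ∀ n : ℕ, dist y (g ^ n • y) ≤ n * dist y (g • y) := by
    intro n
    induction n with
    | zero => simp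
    | succ n ih =>
      have t := dist_triangle y (g ^ n • y) (g ^ (n + 1) • y)
      have s : dist (g ^ n • y) (g ^ (n + 1) • y) = dist y (g • y) := by
        rw [pow_succ, mul_smul, T.isometric]
      push_cast
      linarith
  obtain ⟨n, hn'⟩ := exists_nat_gt ((2 * dist x y + dist y (g • y)) /
    (dist x (g ^ 2 • x) - dist x (g • x) - dist y (g • y)))
  rw [div_lt_iff₀ (by linarith)] at hn'
  have e := T.dist_pow_smul g x h n
  have b := hn (n + 1)
  have t := dist_triangle4 x y (g ^ (n + 1) • y) (g ^ (n + 1) • x)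
  rw [T.isometric, dist_comm y x] at t
  push_cast at b
  have := dist_nonneg (x := x) (y := g • x)
  linarith

end FNTree

/-! ### Equivariant maps and their volumes -/

namespace MarkedGraph

variable {N : ℕ} {Γ : MarkedGraph.{u} N} {T : FNTree.{w} N}

/-- An `F_N`-equivariant map from the vertices of the universal cover of a marked graph to a tree,
without any condition relating it to lengths of edges. -/
structure EquivariantMap (Γ : MarkedGraph.{u} N) (T : FNTree.{w} N) where
  toFun : Γ.V → T.carrier
  map_smul : ∀ (g : FreeGroup (Fin N)) (x : Γ.V), toFun (g • x) = g • toFun x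

/-- The equivariant map on vertices underlying a difference of markings. -/
def Simplex.DiffOfMarkings.toEquivariantMap {S : Γ.Simplex} (f : S.DiffOfMarkings T) :
    EquivariantMap Γ T := ⟨f.toFun, f.map_smul⟩

theorem proj_surjective : Function.Surjective Γ.proj := Quotient.mk_surjective

theorem exists_ne_one (hN : N ≠ 0) : ∃ g : FreeGroup (Fin N), g ≠ 1 :=
  ⟨FreeGroup.of ⟨0, Nat.pos_of_ne_zero hN⟩, FreeGroup.of_ne_one _⟩

namespace EquivariantMap

variable (φ : EquivariantMap Γ T)

/-- The length of the image of an edge of the marked graph. -/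
def length : Γ.OEdge → ℝ :=
  Quotient.lift (fun d : Γ.tree.Dart => dist (φ.toFun d.fst) (φ.toFun d.snd)) (by
    rintro a b ⟨g, rfl⟩
    change dist (φ.toFun (g • b.fst)) (φ.toFun (g • b.snd)) = _
    rw [φ.map_smul, φ.map_smul, T.isometric])

theorem length_proj (d : Γ.tree.Dart) :
    φ.length (Γ.proj d) = dist (φ.toFun d.fst) (φ.toFun d.snd) := rfl

theorem length_nonneg (e : Γ.OEdge) : 0 ≤ φ.length e := by
  obtain ⟨d, rfl⟩ := proj_surjective e
  exact dist_nonneg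

theorem length_revEdge (e : Γ.OEdge) : φ.length (Γ.revEdge e) = φ.length e := by
  obtain ⟨d, rfl⟩ := proj_surjective e
  exact dist_comm _ _

/-- The total length of the image of the marked graph. Every edge appears with both orientations in
the sum. -/
noncomputable def volume : ℝ := (∑ᶠ e, φ.length e) / 2

theorem length_le_volume (e : Γ.OEdge) : φ.length e ≤ 2 * φ.volume := by
  have := Fintype.ofFinite Γ.OEdge
  rw [volume, finsum_eq_sum_of_fintype, mul_div_cancel₀ _ two_ne_zero]
  exact Finset.single_le_sum (fun e _ => φ.length_nonneg e) (Finset.mem_univ e)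

theorem dist_le_walk_length {x y : Γ.V} (p : Γ.tree.Walk x y) :
    dist (φ.toFun x) (φ.toFun y) ≤ p.length * (2 * φ.volume) := by
  induction p with
  | nil => simp
  | cons h p ih =>
    have h1 := φ.length_le_volume (Γ.proj ⟨(_, _), h⟩)
    rw [length_proj] at h1
    have h2 := dist_triangle (φ.toFun _) (φ.toFun _) (φ.toFun _) |>.trans (add_le_add h1 ih)
    refine h2.trans (le_of_eq ?_)
    rw [SimpleGraph.Walk.length_cons]
    push_cast
    ring

end EquivariantMap

/-- Translation lengths in `T` bound the volumes of equivariant maps to `T` from below. -/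
theorem exists_pos_le_volume (hN : N ≠ 0) (Γ : MarkedGraph.{u} N) (T : FNTree.{w} N) :
    ∃ c > 0, ∀ φ : EquivariantMap Γ T, c ≤ φ.volume := by
  obtain ⟨g, hg⟩ := exists_ne_one hN
  obtain ⟨c, hc, h⟩ := T.exists_pos_le_dist_smul hg
  obtain ⟨x⟩ := Γ.isTree.connected.nonempty
  obtain ⟨p⟩ := Γ.isTree.connected.preconnected x (g • x)
  have hp : 0 < p.length := by
    rw [Nat.pos_iff_ne_zero]
    intro h0
    exact hg (Γ.free g x (SimpleGraph.Walk.eq_of_length_eq_zero h0).symm)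
  have hp' : (0 : ℝ) < p.length := by exact_mod_cast hp
  refine ⟨c / (p.length * 2), by positivity, fun φ => ?_⟩
  have h1 := φ.dist_le_walk_length p
  rw [φ.map_smul] at h1
  have h2 := h (φ.toFun x)
  rw [div_le_iff₀ (by positivity)]
  linarith

namespace Simplex

variable {S : Γ.Simplex}

theorem exists_len_pos (S : Γ.Simplex) : ∃ e, 0 < S.len e := by
  by_contra! h
  have h0 : ∀ e, S.len e = 0 := fun e => le_antisymm (h e) (S.len_nonneg e)
  have := S.volume
  simp [h0] at this

namespace DiffOfMarkings

variable (f : S.DiffOfMarkings T)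

theorem slope_eq (d : Γ.tree.Dart) :
    f.slope d = f.toEquivariantMap.length (Γ.proj d) / S.len (Γ.proj d) := rfl

theorem finite_range_slope : (Set.range f.slope).Finite := by
  refine (Set.finite_range fun e => f.toEquivariantMap.length e / S.len e).subset ?_
  rintro _ ⟨d, rfl⟩
  exact ⟨Γ.proj d, rfl⟩

theorem slope_le_maxSlope (d : Γ.tree.Dart) : f.slope d ≤ f.maxSlope :=
  le_ciSup f.finite_range_slope.bddAbove d

theorem length_eq_zero {e : Γ.OEdge} (he : S.len e = 0) : f.toEquivariantMap.length e = 0 := by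
  obtain ⟨d, rfl⟩ := proj_surjective e
  exact dist_eq_zero.2 (f.map_zero d he)

theorem length_le (e : Γ.OEdge) :
    f.toEquivariantMap.length e ≤ f.maxSlope * S.len e := by
  rcases (S.len_nonneg e).eq_or_lt with h | h
  · rw [f.length_eq_zero h.symm, ← h, mul_zero]
  · obtain ⟨d, rfl⟩ := proj_surjective e
    rw [← div_le_iff₀ h]
    exact f.slope_le_maxSlope d

/-- The point of the simplex has volume one, so the largest slope is at least the average slope. -/
theorem volume_le_maxSlope : f.toEquivariantMap.volume ≤ f.maxSlope := by
  have := Fintype.ofFinite Γ.OEdge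
  have h := S.volume
  rw [finsum_eq_sum_of_fintype] at h
  rw [EquivariantMap.volume, finsum_eq_sum_of_fintype]
  have := Finset.sum_le_sum fun e (_ : e ∈ Finset.univ) => f.length_le e
  rw [← Finset.mul_sum] at this
  calc _ ≤ f.maxSlope * (∑ e, S.len e) / 2 := by gcongr
    _ = f.maxSlope := by rw [mul_div_assoc, h, mul_one]

/-- If the largest slope is the average slope, then all slopes agree. -/
theorem length_eq_of_maxSlope_le (h : f.maxSlope ≤ f.toEquivariantMap.volume) (e : Γ.OEdge) :
    f.toEquivariantMap.length e = f.maxSlope * S.len e := by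
  have := Fintype.ofFinite Γ.OEdge
  have hS := S.volume
  rw [finsum_eq_sum_of_fintype] at hS
  rw [EquivariantMap.volume, finsum_eq_sum_of_fintype] at h
  refine (Finset.sum_eq_sum_iff_of_le fun e _ => f.length_le e).1 ?_ e (Finset.mem_univ e)
  refine le_antisymm (Finset.sum_le_sum fun e _ => f.length_le e) ?_
  rw [← Finset.mul_sum, (div_eq_iff two_ne_zero).1 hS]
  linarith

end DiffOfMarkings

/-- The slopes are bounded below by a positive constant, so the infimum of their logarithms that
defines the Lipschitz distance is not a junk value. -/
theorem exists_pos_le_maxSlope (hN : N ≠ 0) (T : FNTree.{w} N) : ∃ c : ℝ, 0 < c ∧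
    ∀ (S : Γ.Simplex) (f : S.DiffOfMarkings T), c ≤ f.maxSlope := by
  obtain ⟨c, hc, h⟩ := exists_pos_le_volume hN Γ T
  exact ⟨c, hc, fun S f => (h _).trans f.volume_le_maxSlope⟩

theorem maxSlope_pos (hN : N ≠ 0) (f : S.DiffOfMarkings T) : 0 < f.maxSlope := by
  obtain ⟨c, hc, h⟩ := exists_pos_le_maxSlope (Γ := Γ) hN T
  exact hc.trans_le (h S f)

theorem lipDist_le (hN : N ≠ 0) (f : S.DiffOfMarkings T) :
    S.lipDist T ≤ Real.log f.maxSlope := by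
  obtain ⟨c, hc, h⟩ := exists_pos_le_maxSlope (Γ := Γ) hN T
  refine ciInf_le ⟨Real.log c, ?_⟩ f
  rintro _ ⟨f, rfl⟩
  exact Real.log_le_log hc (h S f)

end Simplex

namespace EquivariantMap

variable (φ : EquivariantMap Γ T)

/-- The lengths of the images of the edges under an equivariant map, rescaled to total length one.
The edges of length zero form a forest because the action on the target is free. -/
noncomputable def simplex (hN : N ≠ 0) : Γ.Simplex where
  len e := φ.length e / φ.volume
  len_rev e := by rw [φ.length_revEdge]
  len_nonneg e := by
    obtain ⟨c, hc, h⟩ := exists_pos_le_volume hN Γ T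
    exact div_nonneg (φ.length_nonneg e) (hc.le.trans (h φ))
  volume := by
    obtain ⟨c, hc, h⟩ := exists_pos_le_volume hN Γ T
    have hv : φ.volume ≠ 0 := (hc.trans_le (h φ)).ne'
    simp_rw [div_eq_mul_inv]
    rw [← finsum_mul, mul_right_comm, ← div_eq_mul_inv _ (2 : ℝ)]
    exact mul_inv_cancel₀ hv
  forest := by
    obtain ⟨c, hc, h⟩ := exists_pos_le_volume hN Γ T
    have hv : φ.volume ≠ 0 := (hc.trans_le (h φ)).ne'
    rintro g x ⟨p⟩
    have key : ∀ {x y : Γ.V}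
        (_ : (Γ.zeroGraph (fun e => φ.length e / φ.volume) (by simp [φ.length_revEdge])).Walk x y),
        φ.toFun x = φ.toFun y := by
      intro x y p
      induction p with
      | nil => rfl
      | cons h p ih =>
        obtain ⟨h, h0⟩ := h
        refine Eq.trans ?_ ih
        rw [div_eq_zero_iff, or_iff_left hv] at h0
        exact dist_eq_zero.1 h0
    have h1 := key p
    rw [φ.map_smul] at h1
    exact T.free g _ h1.symm

/-- An equivariant map has constant slope, its volume, on the metric graph that it induces. -/
noncomputable def diffOfMarkings (hN : N ≠ 0) : (φ.simplex hN).DiffOfMarkings T where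
  toFun := φ.toFun
  map_smul := φ.map_smul
  map_zero d h := by
    obtain ⟨c, hc, hv⟩ := exists_pos_le_volume hN Γ T
    have h : φ.length (Γ.proj d) / φ.volume = 0 := h
    rw [div_eq_zero_iff, or_iff_left (hc.trans_le (hv φ)).ne'] at h
    exact dist_eq_zero.1 h

theorem maxSlope_diffOfMarkings_le (hN : N ≠ 0) :
    (φ.diffOfMarkings hN).maxSlope ≤ φ.volume := by
  obtain ⟨c, hc, hv⟩ := exists_pos_le_volume hN Γ T
  have hv : 0 < φ.volume := hc.trans_le (hv φ)
  obtain ⟨e, -⟩ := (φ.simplex hN).exists_len_pos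
  obtain ⟨d, rfl⟩ := proj_surjective e
  have : Nonempty Γ.tree.Dart := ⟨d⟩
  refine ciSup_le fun d => ?_
  change φ.length (Γ.proj d) / (φ.length (Γ.proj d) / φ.volume) ≤ _
  by_cases h0 : φ.length (Γ.proj d) = 0
  · rw [h0, zero_div]
    exact hv.le
  · rw [div_div_cancel₀ h0]

end EquivariantMap

/-! ### Minimising points and maps of least volume -/

namespace Simplex

variable {S : Γ.Simplex}

/-- At a minimising point, an optimal map minimises the volume among all equivariant maps. -/
theorem IsMinimizer.maxSlope_le_volume (hN : N ≠ 0) (hS : S.IsMinimizer T)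
    {f : S.DiffOfMarkings T} (hf : f.IsOptimal) (φ : EquivariantMap Γ T) :
    f.maxSlope ≤ φ.volume := by
  have h1 : Real.log f.maxSlope ≤ Real.log (φ.diffOfMarkings hN).maxSlope := by
    rw [← hf]
    exact (hS _).trans (lipDist_le hN _)
  exact ((Real.log_le_log_iff (maxSlope_pos hN f) (maxSlope_pos hN _)).1 h1).trans
    (φ.maxSlope_diffOfMarkings_le hN)

/-- Equivariant maps to `T` that collapse the edges of length zero can be prescribed freely on one
vertex from each class. -/
theorem exists_diffOfMarkings (S : Γ.Simplex) (t : Quotient S.vertSetoid → T.carrier) :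
    ∃ f : S.DiffOfMarkings T, ∀ (q : Quotient S.vertSetoid) (g : FreeGroup (Fin N)) (y : Γ.V),
      S.SameVertex y (g • q.out) → f.toFun y = g • t q := by
  have hex : ∀ y : Γ.V, ∃ g : FreeGroup (Fin N),
      S.SameVertex y (g • (Quotient.mk S.vertSetoid y).out) := fun y =>
    Quotient.exact (Quotient.out_eq (Quotient.mk S.vertSetoid y)).symm
  choose γ hγ using hex
  have key : ∀ (q : Quotient S.vertSetoid) (g : FreeGroup (Fin N)) (y : Γ.V),
      S.SameVertex y (g • q.out) → γ y • t (Quotient.mk S.vertSetoid y) = g • t q := by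
    intro q g y h
    have hq : Quotient.mk S.vertSetoid y = q := by
      rw [← Quotient.out_eq q]
      exact Quotient.sound ⟨g, h⟩
    have h1 := hγ y
    rw [hq] at h1 ⊢
    have h2 := S.sameVertex_smul g⁻¹ (h.symm.trans h1)
    rw [inv_smul_smul, ← mul_smul] at h2
    rw [inv_mul_eq_one.1 (S.forest _ _ h2)]
  refine ⟨⟨fun y => γ y • t (Quotient.mk S.vertSetoid y), fun g x => ?_, fun d hd => ?_⟩, key⟩
  · rw [← mul_smul]
    have hx : Quotient.mk S.vertSetoid (g • x) = Quotient.mk S.vertSetoid x :=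
      Quotient.sound ⟨g, SimpleGraph.Reachable.refl _⟩
    refine key _ _ _ ?_
    rw [mul_smul]
    exact S.sameVertex_smul g (hγ x)
  · refine key _ _ _ (SimpleGraph.Reachable.trans ?_ (hγ d.snd))
    exact SimpleGraph.Adj.reachable ⟨d.adj, hd⟩

end Simplex
end MarkedGraph

/-! ### Existence of minimising points -/

open Filter Topology

namespace MarkedGraph

variable {N : ℕ} {Γ : MarkedGraph.{u} N} {T : FNTree.{w} N}

/-- The barycentre of the simplex: all edges have the same length. -/
theorem nonempty_simplex (Γ : MarkedGraph.{u} N) : Nonempty Γ.Simplex := by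
  have := Fintype.ofFinite Γ.OEdge
  obtain ⟨x⟩ := Γ.isTree.connected.nonempty
  obtain ⟨y, hy⟩ := Set.nonempty_of_ncard_ne_zero
    (show (Γ.tree.neighborSet x).ncard ≠ 0 by have := Γ.three_le_valence x; omega)
  have : Nonempty Γ.OEdge := ⟨Γ.proj ⟨(x, y), hy⟩⟩
  have hc : (0 : ℝ) < Fintype.card Γ.OEdge := by exact_mod_cast Fintype.card_pos
  refine ⟨⟨fun _ => 2 / Fintype.card Γ.OEdge, fun _ => rfl, fun _ => by positivity, ?_, ?_⟩⟩
  · rw [finsum_eq_sum_of_fintype, Finset.sum_const, Finset.card_univ, nsmul_eq_mul]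
    field_simp
  · rintro g x ⟨p⟩
    generalize hy : g • x = y at p
    cases p with
    | nil => exact Γ.free g x hy
    | cons h p => exact absurd h.2 (by positivity)

theorem nonempty_equivariantMap (Γ : MarkedGraph.{u} N) (T : FNTree.{w} N) :
    Nonempty (EquivariantMap Γ T) := by
  obtain ⟨S⟩ := Γ.nonempty_simplex
  obtain ⟨t⟩ := T.isRTree.nonempty
  obtain ⟨f, -⟩ := S.exists_diffOfMarkings fun _ => t
  exact ⟨f.toEquivariantMap⟩

namespace Simplex

/-- If the lengths of the images of edges under equivariant maps converge, up to a scalar, to a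
function on the edges, then the images of vertices that are joined by edges of length zero in the
limit approach each other. -/
theorem tendsto_dist_of_walk {φ : ℕ → EquivariantMap Γ T} {len : Γ.OEdge → ℝ} {v : ℝ}
    (hlen : ∀ e, len (Γ.revEdge e) = len e)
    (h : ∀ e, Tendsto (fun n => (φ n).length e) atTop (𝓝 (v * len e))) {x y : Γ.V}
    (p : (Γ.zeroGraph len hlen).Walk x y) :
    Tendsto (fun n => dist ((φ n).toFun x) ((φ n).toFun y)) atTop (𝓝 0) := by
  induction p with
  | nil => simp
  | cons hadj p ih =>
    obtain ⟨hadj, h0⟩ := hadj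
    have h1 := h (Γ.proj ⟨(_, _), hadj⟩)
    rw [h0, mul_zero] at h1
    have h2 := h1.add ih
    rw [add_zero] at h2
    exact squeeze_zero (fun _ => dist_nonneg) (fun n => dist_triangle _ _ _) h2

/-- The distance to `T` is at most the limit of the slopes of a sequence of equivariant maps whose
lengths of edges converge up to a scalar, even when lengths tend to zero: the maps may be modified
slightly so as to collapse the edges of length zero. -/
theorem lipDist_le_of_tendsto (hN : N ≠ 0) (S : Γ.Simplex) {φ : ℕ → EquivariantMap Γ T} {v : ℝ}
    (hv : 0 < v) (h : ∀ e, Tendsto (fun n => (φ n).length e) atTop (𝓝 (v * S.len e))) :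
    S.lipDist T ≤ Real.log v := by
  choose f hf using fun n => S.exists_diffOfMarkings fun q => (φ n).toFun q.out
  have hclose : ∀ y, Tendsto (fun n => dist ((f n).toFun y) ((φ n).toFun y)) atTop (𝓝 0) := by
    intro y
    obtain ⟨g, p⟩ : ∃ g : FreeGroup (Fin N),
        S.SameVertex y (g • (Quotient.mk S.vertSetoid y).out) :=
      Quotient.exact (Quotient.out_eq (Quotient.mk S.vertSetoid y)).symm
    have h1 : ∀ n, (f n).toFun y = (φ n).toFun (g • (Quotient.mk S.vertSetoid y).out) := fun n => by
      rw [hf n _ g y p, (φ n).map_smul]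
    obtain ⟨p⟩ := p.symm
    simp_rw [h1]
    exact tendsto_dist_of_walk S.len_rev h p
  have hslope : ∀ v' > v, ∀ e : Γ.OEdge, ∀ᶠ n in atTop,
      (f n).toEquivariantMap.length e ≤ v' * S.len e := by
    intro v' hv' e
    rcases (S.len_nonneg e).eq_or_lt with h0 | h0
    · exact Eventually.of_forall fun n => by rw [(f n).length_eq_zero h0.symm, ← h0, mul_zero]
    · obtain ⟨d, rfl⟩ := proj_surjective e
      have h1 := ((hclose d.fst).add (h (Γ.proj d))).add (hclose d.snd)
      rw [zero_add, add_zero] at h1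
      filter_upwards [h1.eventually_lt_const (mul_lt_mul_of_pos_right hv' h0)] with n hn
      refine le_trans ?_ hn.le
      rw [EquivariantMap.length_proj, EquivariantMap.length_proj, dist_comm ((f n).toFun d.snd)]
      exact dist_triangle4 _ _ _ _
  have hle : ∀ v' > v, S.lipDist T ≤ Real.log v' := by
    intro v' hv'
    obtain ⟨n, hn⟩ := (eventually_all.2 (hslope v' hv')).exists
    refine (lipDist_le hN (f n)).trans (Real.log_le_log (maxSlope_pos hN _) ?_)
    obtain ⟨e, -⟩ := S.exists_len_pos
    obtain ⟨d, rfl⟩ := proj_surjective e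
    have : Nonempty Γ.tree.Dart := ⟨d⟩
    exact ciSup_le fun d => div_le_of_le_mul₀ (S.len_nonneg _) (hv.trans hv').le (hn (Γ.proj d))
  have hlim : Tendsto Real.log (𝓝[>] v) (𝓝 (Real.log v)) :=
    (Real.continuousAt_log hv.ne').tendsto.mono_left nhdsWithin_le_nhds
  exact ge_of_tendsto hlim (eventually_nhdsWithin_of_forall hle)

theorem exists_isMinimizer (hN : N ≠ 0) (Γ : MarkedGraph.{u} N) (T : FNTree.{w} N) :
    ∃ S : Γ.Simplex, S.IsMinimizer T := by
  have := Fintype.ofFinite Γ.OEdge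
  have := nonempty_equivariantMap Γ T
  obtain ⟨c, hc, hcv⟩ := exists_pos_le_volume hN Γ T
  have hbdd : BddBelow (Set.range fun φ : EquivariantMap Γ T => φ.volume) :=
    ⟨c, by rintro _ ⟨φ, rfl⟩; exact hcv φ⟩
  set v := ⨅ φ : EquivariantMap Γ T, φ.volume with hvdef
  have hv : 0 < v := hc.trans_le (le_ciInf hcv)
  obtain ⟨u, -, hu, huv⟩ := exists_seq_tendsto_sInf
    (Set.range_nonempty fun φ : EquivariantMap Γ T => φ.volume) hbdd
  choose φ hφ using huv
  have hφv : Tendsto (fun n => (φ n).volume) atTop (𝓝 v) := by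
    simp only at hφ
    simp_rw [hφ]
    exact hu
  have hcpt : IsCompact (Set.univ.pi fun _ : Γ.OEdge => Set.Icc (0 : ℝ) 2) :=
    isCompact_univ_pi fun _ => isCompact_Icc
  obtain ⟨ℓ, -, k, hk, hℓ⟩ := hcpt.tendsto_subseq (x := fun n => ((φ n).simplex hN).len) (by
    intro n e _
    refine ⟨((φ n).simplex hN).len_nonneg e, ?_⟩
    exact div_le_of_le_mul₀ (hc.le.trans (hcv _)) two_pos.le ((φ n).length_le_volume e))
  rw [tendsto_pi_nhds] at hℓ
  have hkv : Tendsto (fun n => (φ (k n)).volume) atTop (𝓝 v) := hφv.comp hk.tendsto_atTop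
  have hlim : ∀ e, Tendsto (fun n => (φ (k n)).length e) atTop (𝓝 (v * ℓ e)) := by
    intro e
    refine (hkv.mul (hℓ e)).congr fun n => ?_
    exact mul_div_cancel₀ _ (hc.trans_le (hcv _)).ne'
  have hrev : ∀ e, ℓ (Γ.revEdge e) = ℓ e := fun e =>
    tendsto_nhds_unique (hℓ (Γ.revEdge e))
      ((hℓ e).congr fun n => (((φ (k n)).simplex hN).len_rev e).symm)
  let S : Γ.Simplex :=
    { len := ℓ
      len_rev := hrev
      len_nonneg := fun e =>
        ge_of_tendsto' (hℓ e) fun n => ((φ (k n)).simplex hN).len_nonneg e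
      volume := by
        rw [finsum_eq_sum_of_fintype]
        refine tendsto_nhds_unique
          ((tendsto_finsetSum Finset.univ fun e _ => hℓ e).div_const 2) ?_
        refine tendsto_const_nhds.congr fun n => ?_
        rw [← ((φ (k n)).simplex hN).volume, finsum_eq_sum_of_fintype]
        rfl
      forest := by
        -- the translation length of `g` in `T` keeps its length in the graphs away from zero
        rintro g x ⟨p⟩
        by_contra hg
        obtain ⟨b, hb, hgb⟩ := T.exists_pos_le_dist_smul hg
        have h0 := tendsto_dist_of_walk hrev hlim p
        simp_rw [EquivariantMap.map_smul] at h0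
        exact hb.not_ge (ge_of_tendsto' h0 fun n => hgb _) }
  refine ⟨S, fun S' => (lipDist_le_of_tendsto hN S hv hlim).trans ?_⟩
  obtain ⟨t⟩ := T.isRTree.nonempty
  have : Nonempty (S'.DiffOfMarkings T) := ⟨(S'.exists_diffOfMarkings fun _ => t).choose⟩
  refine le_ciInf fun f => Real.log_le_log hv ?_
  exact (ciInf_le hbdd f.toEquivariantMap).trans f.volume_le_maxSlope

end Simplex
end MarkedGraph

/-! ### Gates and moves of vertices -/

namespace IsRTree

variable {X : Type u} [MetricSpace X]

/-- Moving from `p` towards `q` by at most the Gromov product of `q` and `z` at `p` is moving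
towards `z`. -/
theorem dist_le_sub_of_gromovProduct (hX : IsRTree X) {p p' q z : X} {ε : ℝ}
    (h1 : dist p p' = ε) (h2 : dist p' q = dist p q - ε)
    (h : 2 * ε ≤ dist p q + dist p z - dist q z) : dist p' z ≤ dist p z - ε := by
  have k := hX.four_point p' z p q
  rw [dist_comm p' p, dist_comm z q, dist_comm z p, h1, h2] at k
  rcases le_max_iff.1 k with k | k <;> linarith

/-- Moving both end points of a segment by `ε` towards each other shortens it by `2ε`. -/
theorem dist_le_sub_two_mul (hX : IsRTree X) {x x' y y' : X} {ε : ℝ} (hε : 2 * ε ≤ dist x y)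
    (hx : dist x x' ≤ ε) (hy : dist y y' ≤ ε) (hx' : dist x' y ≤ dist x y - ε)
    (hy' : dist y' x ≤ dist x y - ε) : dist x' y' ≤ dist x y - 2 * ε := by
  have k := hX.four_point x' y' x y
  rw [dist_comm x' x, dist_comm y' y] at k
  rcases le_max_iff.1 k with k | k <;> linarith

end IsRTree

namespace MarkedGraph.Simplex

variable {N : ℕ} {Γ : MarkedGraph.{u} N} {T : FNTree.{w} N} {S : Γ.Simplex}

instance : Finite S.quotientGraph.Edge := inferInstanceAs (Finite {e : Γ.OEdge // 0 < S.len e})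

theorem src_of_proj_eq {a : S.quotientGraph.Edge} {d : Γ.tree.Dart} (h : Γ.proj d = a.1) :
    S.quotientGraph.src a = Quotient.mk S.vertSetoid d.fst := by
  obtain ⟨a, ha⟩ := a
  subst h
  rfl

theorem exists_lift {a : S.quotientGraph.Edge} {x : Γ.V}
    (h : S.quotientGraph.src a = Quotient.mk S.vertSetoid x) :
    ∃ d : Γ.tree.Dart, Γ.proj d = a.1 ∧ S.SameVertex d.fst x := by
  obtain ⟨d, hd⟩ := proj_surjective a.1
  rw [src_of_proj_eq hd] at h
  obtain ⟨g, hg⟩ := Quotient.exact h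
  refine ⟨g⁻¹ • d, (Γ.proj_smul _ _).trans hd, ?_⟩
  have := S.sameVertex_smul g⁻¹ hg
  rwa [inv_smul_smul] at this

/-- Directions of the quotient graph lift uniquely to a given vertex of the tree `T₀`. -/
theorem eq_of_sameVertex {d d' : Γ.tree.Dart} (h : Γ.proj d = Γ.proj d')
    (hv : S.SameVertex d.fst d'.fst) : d = d' := by
  obtain ⟨g, rfl⟩ := Γ.proj_eq_iff.1 h
  rw [S.forest g _ (SimpleGraph.Reachable.symm hv), one_smul]

namespace DiffOfMarkings

variable (f : S.DiffOfMarkings T)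

theorem eq_of_sameVertex {x y : Γ.V} (h : S.SameVertex x y) : f.toFun x = f.toFun y := by
  obtain ⟨p⟩ := h
  induction p with
  | nil => rfl
  | cons h p ih => exact (f.map_zero ⟨(_, _), h.1⟩ h.2).trans ih

theorem sameGate_iff {a b : S.quotientGraph.Edge} {d d' : Γ.tree.Dart} (ha : Γ.proj d = a.1)
    (hb : Γ.proj d' = b.1) (h : S.SameVertex d.fst d'.fst) :
    f.SameGate a b ↔ dist (f.toFun d.snd) (f.toFun d'.snd) <
      dist (f.toFun d.fst) (f.toFun d.snd) + dist (f.toFun d'.fst) (f.toFun d'.snd) := by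
  refine ⟨?_, fun hlt => ⟨d, d', ha, hb, h, hlt⟩⟩
  rintro ⟨e, e', he, he', hv, hlt⟩
  obtain ⟨g, rfl⟩ := Γ.proj_eq_iff.1 (he.trans ha.symm)
  have he' : g • d' = e' := by
    refine Simplex.eq_of_sameVertex (S := S) ?_ ((S.sameVertex_smul g h).symm.trans hv)
    rw [proj_smul, hb, he']
  subst he'
  change dist (f.toFun (g • d.snd)) (f.toFun (g • d'.snd)) <
    dist (f.toFun (g • d.fst)) (f.toFun (g • d.snd)) +
    dist (f.toFun (g • d'.fst)) (f.toFun (g • d'.snd)) at hlt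
  simpa only [f.map_smul, T.isometric] using hlt

theorem src_eq_of_sameGate {a b : S.quotientGraph.Edge} (h : f.SameGate a b) :
    S.quotientGraph.src a = S.quotientGraph.src b := by
  obtain ⟨d, d', ha, hb, hv, -⟩ := h
  rw [src_of_proj_eq ha, src_of_proj_eq hb]
  exact Quotient.sound ⟨1, by rwa [one_smul]⟩

/-- Being in the same gate is an equivalence relation when no edge of `T₀` is collapsed:
transitivity is the hyperbolicity of the Gromov product. -/
theorem sameGate_equivalence
    (hpos : ∀ e : S.quotientGraph.Edge, 0 < f.toEquivariantMap.length e.1) :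
    Equivalence f.SameGate where
  refl a := by
    obtain ⟨d, hd⟩ := proj_surjective a.1
    have := hpos a
    rw [← hd, EquivariantMap.length_proj] at this
    refine ⟨d, d, hd, hd, SimpleGraph.Reachable.refl _, ?_⟩
    rw [dist_self]
    exact add_pos this this
  symm := by
    rintro a b ⟨d, d', ha, hb, hv, h⟩
    exact ⟨d', d, hb, ha, hv.symm, by rwa [dist_comm, add_comm]⟩
  trans := by
    rintro a b c hab ⟨d, d', hb, hc, hv, h⟩
    obtain ⟨e, he, hed⟩ := exists_lift
      ((f.src_eq_of_sameGate hab).trans (src_of_proj_eq hb))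
    have h1 := (f.sameGate_iff he hb hed).1 hab
    refine (f.sameGate_iff he hc (hed.trans hv)).2 ?_
    have hq := f.eq_of_sameVertex hed
    have hq' := f.eq_of_sameVertex hv
    rw [hq] at h1 ⊢
    rw [← hq'] at h ⊢
    have k := T.isRTree.four_point (f.toFun e.snd) (f.toFun d'.snd) (f.toFun d.snd) (f.toFun d.fst)
    rw [dist_comm (f.toFun d.snd) (f.toFun d.fst), dist_comm (f.toFun d'.snd) (f.toFun d.fst),
      dist_comm (f.toFun e.snd) (f.toFun d.fst), dist_comm (f.toFun d'.snd) (f.toFun d.snd)] at k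
    rcases le_max_iff.1 k with k | k <;> linarith

theorem volume_eq_sum [Fintype S.quotientGraph.Edge] : f.toEquivariantMap.volume =
    (∑ e : S.quotientGraph.Edge, f.toEquivariantMap.length e.1) / 2 := by
  classical
  have := Fintype.ofFinite Γ.OEdge
  rw [EquivariantMap.volume, finsum_eq_sum_of_fintype]
  congr 1
  rw [← Finset.sum_filter_of_ne (p := fun e => 0 < S.len e) fun e _ he =>
    (S.len_nonneg e).lt_of_ne fun h0 => he (f.length_eq_zero h0.symm)]
  exact Finset.sum_subtype _ (fun e => by simp) _

/-- The image of the vertices over one vertex of `T₀ / F_N` can be moved to a prescribed orbit. -/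
theorem exists_move (x : Γ.V) (p : T.carrier) : ∃ f' : S.DiffOfMarkings T,
    (∀ (g : FreeGroup (Fin N)) (y : Γ.V), S.SameVertex y (g • x) → f'.toFun y = g • p) ∧
    ∀ y : Γ.V, Quotient.mk S.vertSetoid y ≠ Quotient.mk S.vertSetoid x →
      f'.toFun y = f.toFun y := by
  classical
  have hex : ∀ y : Γ.V, ∃ g : FreeGroup (Fin N),
      S.SameVertex y (g • (Quotient.mk S.vertSetoid y).out) := fun y =>
    Quotient.exact (Quotient.out_eq (Quotient.mk S.vertSetoid y)).symm
  obtain ⟨k, hk⟩ := hex x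
  obtain ⟨f', hf'⟩ := S.exists_diffOfMarkings fun q =>
    if q = Quotient.mk S.vertSetoid x then k⁻¹ • p else f.toFun q.out
  refine ⟨f', fun g y h => ?_, fun y h => ?_⟩
  · have := hf' (Quotient.mk S.vertSetoid x) (g * k) y
      (h.trans (by rw [mul_smul]; exact S.sameVertex_smul g hk))
    rw [this, if_pos rfl, ← mul_smul, mul_inv_cancel_right]
  · obtain ⟨g, hg⟩ := hex y
    rw [hf' _ g y hg, if_neg h, ← f.map_smul]
    exact (f.eq_of_sameVertex hg).symm

open Classical in
/-- The weight of a direction `b` relative to the gate of `a`: `-1` if `b` is in the gate, `1` if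
`b` is another direction at the same vertex, and `0` otherwise. When the image of the vertex is
moved by a small `ε` into the gate, `ε` times the weight bounds the contribution of `b` to the
change of volume. -/
noncomputable def gateWeight (a b : S.quotientGraph.Edge) : ℝ :=
  (if S.quotientGraph.src b = S.quotientGraph.src a then 1 else 0) -
    2 * if f.SameGate a b then 1 else 0

/-- If `f` minimises the volume among all equivariant maps, then every gate contains at most half of
the directions at its vertex; otherwise moving the image of the vertex into the gate reduces the
volume. -/
theorem sum_gateWeight_nonneg [Fintype S.quotientGraph.Edge]
    (hpos : ∀ e : S.quotientGraph.Edge, 0 < f.toEquivariantMap.length e.1)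
    (hmin : ∀ φ : EquivariantMap Γ T, f.toEquivariantMap.volume ≤ φ.volume)
    (a : S.quotientGraph.Edge) : 0 ≤ ∑ b, f.gateWeight a b := by
  obtain ⟨d₀, hd₀⟩ := proj_surjective a.1
  -- `ε` is so small that moves by `ε` into the gate stay in the initial segments of its directions
  have hε : ∃ ε : ℝ, 0 < ε ∧ ∀ e : S.quotientGraph.Edge,
      2 * ε ≤ f.toEquivariantMap.length e.1 ∧ ∀ d : Γ.tree.Dart, Γ.proj d = e.1 →
        S.SameVertex d₀.fst d.fst → f.SameGate a e →
        2 * ε ≤ dist (f.toFun d₀.fst) (f.toFun d₀.snd) + dist (f.toFun d₀.fst) (f.toFun d.snd) -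
          dist (f.toFun d₀.snd) (f.toFun d.snd) := by
    have hsmall : ∀ c : ℝ, 0 < c → ∀ᶠ ε in 𝓝[>] (0 : ℝ), 2 * ε ≤ c := by
      intro c hc
      filter_upwards [Ioo_mem_nhdsGT (half_pos hc)] with ε hε
      linarith [hε.2]
    have hev : ∀ᶠ ε in 𝓝[>] (0 : ℝ), 0 < ε ∧ ∀ e : S.quotientGraph.Edge,
        2 * ε ≤ f.toEquivariantMap.length e.1 ∧ ∀ d : Γ.tree.Dart, Γ.proj d = e.1 →
          S.SameVertex d₀.fst d.fst → f.SameGate a e →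
          2 * ε ≤ dist (f.toFun d₀.fst) (f.toFun d₀.snd) + dist (f.toFun d₀.fst) (f.toFun d.snd) -
            dist (f.toFun d₀.snd) (f.toFun d.snd) := by
      refine eventually_mem_nhdsWithin.and (eventually_all.2 fun e => (hsmall _ (hpos e)).and ?_)
      by_cases h : ∃ d : Γ.tree.Dart, Γ.proj d = e.1 ∧ S.SameVertex d₀.fst d.fst ∧ f.SameGate a e
      · obtain ⟨d, hd, hv, hg⟩ := h
        have hlt := (f.sameGate_iff hd₀ hd hv).1 hg
        rw [← f.eq_of_sameVertex hv] at hlt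
        filter_upwards [hsmall _ (sub_pos.2 hlt)] with ε hε d' hd' hv' _
        rwa [Simplex.eq_of_sameVertex (S := S) (hd'.trans hd.symm) (hv'.symm.trans hv)]
      · exact Eventually.of_forall fun ε d hd hv hg => absurd ⟨d, hd, hv, hg⟩ h
    exact hev.exists
  obtain ⟨ε, hε0, hε⟩ := hε
  have hεa := (hε a).1
  rw [← hd₀, EquivariantMap.length_proj] at hεa
  change 2 * ε ≤ dist (f.toFun d₀.fst) (f.toFun d₀.snd) at hεa
  obtain ⟨p', hp1, hp2⟩ := T.isRTree.exists_dist_eq (f.toFun d₀.fst) (f.toFun d₀.snd) hε0.le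
    (by linarith)
  obtain ⟨f', hf1, hf2⟩ := f.exists_move d₀.fst p'
  -- the effect of the move on the origin of an edge: it moves by at most `ε`, and unless it moves
  -- along the edge, its displacement is accounted for by the weight
  have hdir : ∀ (b : S.quotientGraph.Edge) (d : Γ.tree.Dart), Γ.proj d = b.1 →
      dist (f.toFun d.fst) (f'.toFun d.fst) ≤ ε ∧
      dist (f'.toFun d.fst) (f.toFun d.snd) ≤
        dist (f.toFun d.fst) (f.toFun d.snd) + ε * f.gateWeight a b ∧
      (f.gateWeight a b = -1 ∨ dist (f.toFun d.fst) (f'.toFun d.fst) ≤ ε * f.gateWeight a b) := by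
    intro b d hd
    by_cases hsrc : S.quotientGraph.src b = S.quotientGraph.src a
    · have hs := hsrc
      rw [src_of_proj_eq hd, src_of_proj_eq hd₀] at hs
      obtain ⟨g, hg⟩ := Quotient.exact hs
      have hfd : f.toFun d.fst = g • f.toFun d₀.fst := by
        rw [← f.map_smul]
        exact f.eq_of_sameVertex hg
      have hdist : dist (f.toFun d.fst) (f'.toFun d.fst) = ε := by
        rw [hf1 g _ hg, hfd, T.isometric, hp1]
      refine ⟨hdist.le, ?_⟩
      by_cases hgate : f.SameGate a b
      · have hw : f.gateWeight a b = -1 := by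
          rw [gateWeight, if_pos hsrc, if_pos hgate]
          norm_num
        refine ⟨?_, Or.inl hw⟩
        have hv : S.SameVertex d₀.fst (g⁻¹ • d).fst := by
          have := S.sameVertex_smul g⁻¹ hg
          rw [inv_smul_smul] at this
          exact this.symm
        have h1 := (hε b).2 (g⁻¹ • d) ((Γ.proj_smul _ _).trans hd) hv hgate
        have h2 := T.isRTree.dist_le_sub_of_gromovProduct hp1 hp2 h1
        have h3 : f.toFun (g⁻¹ • d).snd = g⁻¹ • f.toFun d.snd := f.map_smul _ _
        rw [h3, ← T.isometric g, ← T.isometric g (f.toFun d₀.fst), smul_inv_smul, ← hfd,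
          ← hf1 g _ hg] at h2
        rw [hw]
        linarith
      · have hw : f.gateWeight a b = 1 := by
          rw [gateWeight, if_pos hsrc, if_neg hgate]
          norm_num
        rw [hw, mul_one]
        refine ⟨?_, Or.inr hdist.le⟩
        have := dist_triangle (f'.toFun d.fst) (f.toFun d.fst) (f.toFun d.snd)
        rw [dist_comm (f'.toFun d.fst) (f.toFun d.fst), hdist] at this
        linarith
    · have hgate : ¬ f.SameGate a b := fun h => hsrc (f.src_eq_of_sameGate h).symm
      have hw : f.gateWeight a b = 0 := by
        rw [gateWeight, if_neg hsrc, if_neg hgate]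
        norm_num
      have hfd : f'.toFun d.fst = f.toFun d.fst := by
        refine hf2 _ fun h => hsrc ?_
        rw [src_of_proj_eq hd, src_of_proj_eq hd₀, h]
      rw [hw, hfd, dist_self, mul_zero, add_zero]
      exact ⟨hε0.le, le_rfl, Or.inr le_rfl⟩
  have hlen : ∀ b : S.quotientGraph.Edge, f'.toEquivariantMap.length b.1 ≤
      f.toEquivariantMap.length b.1 +
        ε * (f.gateWeight a b + f.gateWeight a (S.quotientGraph.rev b)) := by
    intro b
    obtain ⟨d, hd⟩ := proj_surjective b.1
    obtain ⟨a1, a2, a3⟩ := hdir b d hd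
    obtain ⟨b1, b2, b3⟩ := hdir (S.quotientGraph.rev b) d.symm
      (by rw [← revEdge_proj, hd]; rfl)
    change dist (f.toFun d.snd) (f'.toFun d.snd) ≤ ε at b1
    change dist (f'.toFun d.snd) (f.toFun d.fst) ≤
      dist (f.toFun d.snd) (f.toFun d.fst) + _ at b2
    change _ ∨ dist (f.toFun d.snd) (f'.toFun d.snd) ≤ _ at b3
    have hb := (hε b).1
    rw [← hd, EquivariantMap.length_proj] at hb ⊢
    rw [EquivariantMap.length_proj]
    change 2 * ε ≤ dist (f.toFun d.fst) (f.toFun d.snd) at hb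
    change dist (f'.toFun d.fst) (f'.toFun d.snd) ≤ dist (f.toFun d.fst) (f.toFun d.snd) + _
    rw [dist_comm (f.toFun d.snd) (f.toFun d.fst)] at b2
    rcases a3 with a3 | a3
    · rcases b3 with b3 | b3
      · rw [a3] at a2 ⊢
        rw [b3] at b2 ⊢
        have := T.isRTree.dist_le_sub_two_mul hb a1 b1 (by linarith) (by linarith)
        linarith
      · have := dist_triangle (f'.toFun d.fst) (f.toFun d.snd) (f'.toFun d.snd)
        linarith
    · have := dist_triangle (f'.toFun d.fst) (f.toFun d.fst) (f'.toFun d.snd)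
      rw [dist_comm (f'.toFun d.fst) (f.toFun d.fst),
        dist_comm (f.toFun d.fst) (f'.toFun d.snd)] at this
      linarith
  have hvol := hmin f'.toEquivariantMap
  rw [f.volume_eq_sum, f'.volume_eq_sum] at hvol
  have hsum := Finset.sum_le_sum fun b (_ : b ∈ Finset.univ) => hlen b
  have hrev : ∑ b, f.gateWeight a (S.quotientGraph.rev b) = ∑ b, f.gateWeight a b :=
    Equiv.sum_comp (Function.Involutive.toPerm _ S.quotientGraph.rev_rev) (f.gateWeight a)
  rw [Finset.sum_add_distrib, ← Finset.mul_sum, Finset.sum_add_distrib, hrev] at hsum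
  have : 0 ≤ ε * ∑ b, f.gateWeight a b := by linarith
  exact nonneg_of_mul_nonneg_right this hε0

open Classical in
theorem two_mul_card_gate_le [Fintype S.quotientGraph.Edge]
    (hpos : ∀ e : S.quotientGraph.Edge, 0 < f.toEquivariantMap.length e.1)
    (hmin : ∀ φ : EquivariantMap Γ T, f.toEquivariantMap.volume ≤ φ.volume)
    (a : S.quotientGraph.Edge) :
    2 * (Finset.univ.filter fun b => f.SameGate a b).card ≤
      (Finset.univ.filter fun b => S.quotientGraph.src b = S.quotientGraph.src a).card := by
  have h := f.sum_gateWeight_nonneg hpos hmin a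
  unfold gateWeight at h
  rw [Finset.sum_sub_distrib, ← Finset.mul_sum, Finset.sum_boole, Finset.sum_boole] at h
  exact_mod_cast sub_nonneg.1 h

end DiffOfMarkings
end MarkedGraph.Simplex

/-! ### Legal loops -/

namespace TrainTrack

variable {Γ : Graph.{u, v}} (τ : TrainTrack Γ)

/-- The oriented edge `b` can follow the oriented edge `a` in a legal path. -/
def LegalTurn (a b : Γ.Edge) : Prop := Γ.src b = Γ.src (Γ.rev a) ∧ ¬ τ.rel (Γ.rev a) b

/-- There is a legal path with first edge `a` and last edge `b`, which are distinct terms of the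
path even if they agree. -/
abbrev LegalPath (a b : Γ.Edge) : Prop := Relation.TransGen τ.LegalTurn a b

variable {τ}

theorem LegalTurn.reverse {a b : Γ.Edge} (h : τ.LegalTurn a b) :
    τ.LegalTurn (Γ.rev b) (Γ.rev a) := by
  refine ⟨?_, fun hr => h.2 ?_⟩
  · rw [Γ.rev_rev, h.1]
  · rw [Γ.rev_rev] at hr
    exact τ.equivalence.symm hr

theorem LegalPath.reverse {a b : Γ.Edge} (h : τ.LegalPath a b) :
    τ.LegalPath (Γ.rev b) (Γ.rev a) := by
  induction h with
  | single h => exact .single h.reverse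
  | tail _ h ih => exact .head h.reverse ih

theorem LegalPath.exists_isChain {a b : Γ.Edge} (h : τ.LegalPath a b) :
    ∃ l : List Γ.Edge, List.IsChain τ.LegalTurn (a :: (l ++ [b])) := by
  induction h with
  | single h => exact ⟨[], by simpa using h⟩
  | @tail b c _ h ih =>
    obtain ⟨l, hl⟩ := ih
    exact ⟨l ++ [b], by simpa using ⟨hl, h⟩⟩

variable (τ)

open Classical in
/-- If every gate contains at most half of the directions at its vertex, then the directions can be
permuted so that each is taken to one at the same vertex in another gate. Hall's condition holds for
directions at one vertex because the directions legal for a set of them are all directions if the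
set meets two gates, and the complement of a gate otherwise. -/
theorem exists_injective_legal [Fintype Γ.Edge]
    (hτ : ∀ a, 2 * (Finset.univ.filter fun b => τ.rel a b).card ≤
      (Finset.univ.filter fun b => Γ.src b = Γ.src a).card) :
    ∃ π : Γ.Edge → Γ.Edge, Function.Injective π ∧
      ∀ a, Γ.src (π a) = Γ.src a ∧ ¬ τ.rel a (π a) := by
  let t : Γ.Edge → Finset Γ.Edge := fun a =>
    Finset.univ.filter fun b => Γ.src b = Γ.src a ∧ ¬ τ.rel a b
  obtain ⟨π, hπ, h⟩ := (Finset.all_card_le_biUnion_card_iff_exists_injective t).1 (by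
    intro s
    let V : Finset Γ.Vert := Finset.univ.image Γ.src
    have hV : ∀ u : Finset Γ.Edge, u.card = ∑ x ∈ V, (u.filter fun a => Γ.src a = x).card :=
      fun u => Finset.card_eq_sum_card_fiberwise fun a _ => by simp [V]
    rw [hV s, hV (s.biUnion t)]
    refine Finset.sum_le_sum fun x _ => ?_
    rcases (s.filter fun a => Γ.src a = x).eq_empty_or_nonempty with h0 | ⟨a, ha⟩
    · rw [h0]
      exact Nat.zero_le _
    obtain ⟨has, hax⟩ := Finset.mem_filter.1 ha
    by_cases hall : ∀ b ∈ s, Γ.src b = x → τ.rel a b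
    · have h1 : (s.filter fun a => Γ.src a = x).card ≤
          (Finset.univ.filter fun b => τ.rel a b).card := by
        refine Finset.card_le_card fun b hb => ?_
        obtain ⟨hb, hbx⟩ := Finset.mem_filter.1 hb
        simpa using hall b hb hbx
      have h2 : (Finset.univ.filter fun b => Γ.src b = Γ.src a) ⊆
          (Finset.univ.filter fun b => τ.rel a b) ∪
            ((s.biUnion t).filter fun a => Γ.src a = x) := by
        intro b hb
        have hb : Γ.src b = Γ.src a := by simpa using hb
        by_cases hab : τ.rel a b
        · simp [hab]
        · refine Finset.mem_union_right _ (Finset.mem_filter.2 ⟨?_, hb.trans hax⟩)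
          exact Finset.mem_biUnion.2 ⟨a, has, by simp [t, hb, hab]⟩
      have h3 := (Finset.card_le_card h2).trans (Finset.card_union_le _ _)
      have := hτ a
      omega
    · push Not at hall
      obtain ⟨b, hbs, hbx, hab⟩ := hall
      refine Finset.card_le_card fun c hc => ?_
      obtain ⟨-, hcx⟩ := Finset.mem_filter.1 hc
      refine Finset.mem_filter.2 ⟨Finset.mem_biUnion.2 ?_, hcx⟩
      by_cases hac : τ.rel a c
      · refine ⟨b, hbs, ?_⟩
        have : ¬ τ.rel b c := fun hbc =>
          hab (τ.equivalence.trans hac (τ.equivalence.symm hbc))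
        simp [t, hcx, hbx, this]
      · exact ⟨a, has, by simp [t, hcx, hax, hac]⟩)
  exact ⟨π, hπ, fun a => by simpa [t] using h a⟩

variable {τ}

/-- Suppose that every oriented edge can be continued to a legal loop, by `φ`. Two legal loops
through a common vertex can then be merged into one after reversing one of them if necessary: of
the two ways to recombine the two legal turns at the vertex, at least one is legal. -/
theorem legalPath_of_meet {φ : Γ.Edge → Γ.Edge} (hφ : ∀ a, τ.LegalTurn a (φ a))
    (hback : ∀ a, τ.LegalPath (φ a) a) (hsurj : Function.Surjective φ) {a b : Γ.Edge}
    (hab : Γ.src b = Γ.src (Γ.rev a)) :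
    (τ.LegalPath a b ∧ τ.LegalPath b a) ∨
      (τ.LegalPath a (Γ.rev b) ∧ τ.LegalPath (Γ.rev b) a) := by
  obtain ⟨c, rfl⟩ := hsurj b
  have hc := hφ c
  have ha := hφ a
  have hE := τ.equivalence
  by_cases h : ¬ τ.rel (Γ.rev a) (φ c) ∧ ¬ τ.rel (Γ.rev c) (φ a)
  · left
    refine ⟨.single ⟨hab, h.1⟩, (hback c).trans (.head ⟨?_, h.2⟩ (hback a))⟩
    rw [ha.1, ← hab, hc.1]
  · right
    have h1 : ¬ τ.rel (Γ.rev a) (Γ.rev c) := fun h1 => h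
      ⟨fun h2 => hc.2 (hE.trans (hE.symm h1) h2), fun h2 => ha.2 (hE.trans h1 h2)⟩
    have h2 : ¬ τ.rel (φ c) (φ a) := fun h2 => h
      ⟨fun h3 => ha.2 (hE.trans h3 h2), fun h3 => hc.2 (hE.trans h3 (hE.symm h2))⟩
    refine ⟨.head ⟨?_, h1⟩ (hback c).reverse, .head ⟨?_, ?_⟩ (hback a)⟩
    · rw [← hc.1, hab]
    · rw [Γ.rev_rev, ha.1, hab]
    · rwa [Γ.rev_rev]

/-- If `a` is joined to every edge, in one of its orientations, by legal paths both ways, then some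
legal loop through `a` crosses all edges of a given finite set. -/
theorem exists_loop_of_legalPath {a : Γ.Edge} (ha : τ.LegalPath a a) (s : Finset Γ.Edge)
    (h : ∀ b, (τ.LegalPath a b ∧ τ.LegalPath b a) ∨
      (τ.LegalPath a (Γ.rev b) ∧ τ.LegalPath (Γ.rev b) a)) :
    ∃ l : List Γ.Edge, List.IsChain τ.LegalTurn (a :: (l ++ [a])) ∧
      ∀ b ∈ s, b ∈ l ∨ Γ.rev b ∈ l := by
  classical
  induction s using Finset.induction_on with
  | empty =>
    obtain ⟨l, hl⟩ := ha.exists_isChain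
    exact ⟨l, hl, by simp⟩
  | insert b s _ ih =>
    obtain ⟨l, hl, hls⟩ := ih
    have hx : ∃ x, (x = b ∨ x = Γ.rev b) ∧ τ.LegalPath a x ∧ τ.LegalPath x a := by
      rcases h b with h | h
      · exact ⟨b, Or.inl rfl, h⟩
      · exact ⟨Γ.rev b, Or.inr rfl, h⟩
    obtain ⟨x, hxb, h1, h2⟩ := hx
    obtain ⟨p, hp⟩ := h1.exists_isChain
    obtain ⟨q, hq⟩ := h2.exists_isChain
    refine ⟨l ++ a :: (p ++ x :: q), ?_, fun y hy => ?_⟩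
    · have h3 : List.IsChain τ.LegalTurn (a :: (p ++ x :: (q ++ [a]))) :=
        List.isChain_cons_split.2 ⟨hp, hq⟩
      have h4 : List.IsChain τ.LegalTurn (a :: (l ++ a :: (p ++ x :: (q ++ [a])))) :=
        List.isChain_cons_split.2 ⟨hl, h3⟩
      simpa using h4
    · rcases Finset.mem_insert.1 hy with rfl | hy
      · rcases hxb with rfl | rfl <;> simp
      · rcases hls y hy with h | h <;> simp [h]

theorem isRecurrent_of_isChain {a : Γ.Edge} {l : List Γ.Edge}
    (h : List.IsChain τ.LegalTurn (a :: (l ++ [a]))) (hl : ∀ b, b ∈ l ∨ Γ.rev b ∈ l) :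
    τ.IsRecurrent := by
  refine ⟨l.length, fun i => (a :: l)[i.1], fun i => ?_, fun b => ?_⟩
  · rw [List.isChain_iff_getElem] at h
    have hi := h i.1 (by simp; omega)
    rw [List.getElem_cons_succ] at hi
    have e1 : (a :: (l ++ [a]))[i.1]'(by simp) = (a :: l)[i.1] :=
      List.getElem_append_left (as := a :: l) (bs := [a]) i.2
    have e2 : (l ++ [a])[i.1]'(by simp; omega) = (a :: l)[(i + 1).1] := by
      induction i using Fin.lastCases with
      | last => simp
      | cast j => simp
    rw [e1, e2] at hi
    exact hi
  · have : ∃ x ∈ l, x = b ∨ x = Γ.rev b := by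
      rcases hl b with h | h
      · exact ⟨b, h, Or.inl rfl⟩
      · exact ⟨_, h, Or.inr rfl⟩
    obtain ⟨x, hx, hxb⟩ := this
    obtain ⟨i, hi, rfl⟩ := List.mem_iff_getElem.1 hx
    exact ⟨⟨i + 1, by omega⟩, by simpa using hxb⟩

open Classical in
/-- On a finite connected graph, a train track structure all of whose gates contain at most half of
the directions at their vertex is recurrent. -/
theorem isRecurrent_of_two_mul_card_gate_le [Fintype Γ.Edge] [Nonempty Γ.Edge]
    (hconn : ∀ P : Γ.Edge → Prop, (∃ a, P a) → (∀ a, P a → P (Γ.rev a)) →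
      (∀ a b, Γ.src a = Γ.src b → P a → P b) → ∀ a, P a)
    (hτ : ∀ a, 2 * (Finset.univ.filter fun b => τ.rel a b).card ≤
      (Finset.univ.filter fun b => Γ.src b = Γ.src a).card) :
    τ.IsRecurrent := by
  obtain ⟨π, hπ, hlegal⟩ := τ.exists_injective_legal hτ
  let φ : Γ.Edge → Γ.Edge := fun a => π (Γ.rev a)
  have hinj : Function.Injective φ := hπ.comp (Function.Involutive.injective Γ.rev_rev)
  have hφ : ∀ a, τ.LegalTurn a (φ a) := fun a => hlegal (Γ.rev a)
  have hiter : ∀ (n : ℕ) (a : Γ.Edge), τ.LegalPath a (φ^[n + 1] a) := by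
    intro n
    induction n with
    | zero => exact fun a => .single (hφ a)
    | succ n ih => exact fun a => .head (hφ a) (ih (φ a))
  have hloop : ∀ a, τ.LegalPath a a := by
    intro a
    obtain ⟨n, hn, hp⟩ := Function.mem_periodicPts.1 (hinj.mem_periodicPts a)
    obtain ⟨n, rfl⟩ := Nat.exists_eq_succ_of_ne_zero hn.ne'
    have := hiter n a
    rwa [show φ^[n + 1] a = a from hp] at this
  have hback : ∀ a, τ.LegalPath (φ a) a := by
    intro a
    obtain ⟨n, hn, hp⟩ := Function.mem_periodicPts.1 (hinj.mem_periodicPts a)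
    obtain ⟨n, rfl⟩ := Nat.exists_eq_succ_of_ne_zero hn.ne'
    have := hiter (2 * n) (φ a)
    rwa [← Function.iterate_succ_apply, show φ^[2 * n + 1 + 1] a = a from hp.const_mul 2] at this
  have hmeet := fun {a b} => legalPath_of_meet (a := a) (b := b) hφ hback
    (Finite.surjective_of_injective hinj)
  obtain ⟨a⟩ := ‹Nonempty Γ.Edge›
  let P : Γ.Edge → Prop := fun b => (τ.LegalPath a b ∧ τ.LegalPath b a) ∨
    (τ.LegalPath a (Γ.rev b) ∧ τ.LegalPath (Γ.rev b) a)
  have hrev : ∀ b, P b → P (Γ.rev b) := by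
    intro b hb
    change _ ∨ _
    rw [Γ.rev_rev]
    exact hb.symm
  have hP : ∀ b, P b := by
    refine hconn P ⟨a, Or.inl ⟨hloop a, hloop a⟩⟩ hrev ?_
    intro b c hbc hb
    have key : ∀ {b}, Γ.src c = Γ.src (Γ.rev b) →
        τ.LegalPath a b ∧ τ.LegalPath b a → P c := by
      rintro b hbc ⟨h1, h2⟩
      rcases hmeet hbc with ⟨h3, h4⟩ | ⟨h3, h4⟩
      · exact Or.inl ⟨h1.trans h3, h4.trans h2⟩
      · exact Or.inr ⟨h1.trans h3, h4.trans h2⟩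
    rcases hb with ⟨h1, h2⟩ | hb
    · -- the direction `b` at the vertex is entered along the reverse of `b`
      rcases hmeet (a := Γ.rev b) (b := c) (by rw [Γ.rev_rev, hbc]) with ⟨h3, h4⟩ | ⟨h3, h4⟩
      · have h3 := h3.reverse
        have h4 := h4.reverse
        rw [Γ.rev_rev] at h3 h4
        exact Or.inr ⟨h1.trans h4, h3.trans h2⟩
      · have h3 := h3.reverse
        have h4 := h4.reverse
        rw [Γ.rev_rev, Γ.rev_rev] at h3 h4
        exact Or.inl ⟨h1.trans h4, h3.trans h2⟩
    · exact key (by rw [Γ.rev_rev, hbc]) hb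
  obtain ⟨l, hl, hls⟩ := exists_loop_of_legalPath (hloop a) Finset.univ hP
  exact isRecurrent_of_isChain hl fun b => hls b (Finset.mem_univ b)

end TrainTrack

namespace MarkedGraph.Simplex

variable {N : ℕ} {Γ : MarkedGraph.{u} N} {T : FNTree.{w} N} {S : Γ.Simplex}

/-- The graph `T₀ / F_N` is connected: a property of directions that passes to reverses and to the
other directions at the same vertex holds for all directions or for none. -/
theorem quotientGraph_connected (S : Γ.Simplex) (P : S.quotientGraph.Edge → Prop)
    (h0 : ∃ a, P a) (hrev : ∀ a, P a → P (S.quotientGraph.rev a))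
    (hsrc : ∀ a b, S.quotientGraph.src a = S.quotientGraph.src b → P a → P b) (a) : P a := by
  let Q : Γ.V → Prop := fun x => ∀ b, S.quotientGraph.src b = Quotient.mk S.vertSetoid x → P b
  have hstep : ∀ {x y : Γ.V}, Γ.tree.Walk x y → Q x → Q y := by
    intro x y p
    induction p with
    | nil => exact id
    | @cons x y z hxy p ih =>
      intro hx
      refine ih fun b hb => ?_
      rcases (S.len_nonneg (Γ.proj ⟨(x, y), hxy⟩)).eq_or_lt with h | h
      · refine hx b (hb.trans (Quotient.sound ⟨1, ?_⟩))
        rw [one_smul]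
        exact (SimpleGraph.Adj.reachable ⟨hxy, h.symm⟩ :
          (Γ.zeroGraph S.len S.len_rev).Reachable x y).symm
      · let c : S.quotientGraph.Edge := ⟨Γ.proj ⟨(x, y), hxy⟩, h⟩
        exact hsrc (S.quotientGraph.rev c) b hb.symm (hrev c (hx c rfl))
  obtain ⟨b, hb⟩ := h0
  obtain ⟨d, hd⟩ := proj_surjective b.1
  obtain ⟨d', hd'⟩ := proj_surjective a.1
  obtain ⟨p⟩ := Γ.isTree.connected.preconnected d.fst d'.fst
  exact hstep p (fun c hc => hsrc b c ((src_of_proj_eq hd).trans hc.symm) hb) a (src_of_proj_eq hd')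

/-- Every vertex of `T₀ / F_N` has an edge: otherwise the edges of length zero would join all vertices
of the universal cover, and so carry every element of `F_N`. -/
theorem exists_src_eq (hN : N ≠ 0) (S : Γ.Simplex) (q : S.quotientGraph.Vert) :
    ∃ a, S.quotientGraph.src a = q := by
  obtain ⟨x, rfl⟩ := Quotient.exists_rep q
  by_contra! h
  have hstep : ∀ {y z : Γ.V}, Γ.tree.Walk y z → S.SameVertex x y → S.SameVertex x z := by
    intro y z p
    induction p with
    | nil => exact id
    | @cons y z _ hyz p ih =>
      intro hy
      refine ih ?_
      rcases (S.len_nonneg (Γ.proj ⟨(y, z), hyz⟩)).eq_or_lt with h0 | h0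
      · exact hy.trans (SimpleGraph.Adj.reachable ⟨hyz, h0.symm⟩)
      · refine absurd ?_ (h ⟨Γ.proj ⟨(y, z), hyz⟩, h0⟩)
        exact Quotient.sound ⟨1, by rw [one_smul]; exact hy.symm⟩
  obtain ⟨g, hg⟩ := exists_ne_one hN
  obtain ⟨p⟩ := Γ.isTree.connected.preconnected x (g • x)
  exact hg (S.forest g x (hstep p (SimpleGraph.Reachable.refl x)))

open Classical in
theorem exists_not_sameGate (hN : N ≠ 0) [Fintype S.quotientGraph.Edge] (f : S.DiffOfMarkings T)
    (hE : Equivalence f.SameGate)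
    (hgate : ∀ a, 2 * (Finset.univ.filter fun b => f.SameGate a b).card ≤
      (Finset.univ.filter fun b => S.quotientGraph.src b = S.quotientGraph.src a).card)
    (q : S.quotientGraph.Vert) :
    ∃ a b, S.quotientGraph.src a = q ∧ S.quotientGraph.src b = q ∧ ¬ f.SameGate a b := by
  obtain ⟨a, rfl⟩ := S.exists_src_eq hN q
  by_contra! h
  have h1 : 0 < (Finset.univ.filter fun b => f.SameGate a b).card :=
    Finset.card_pos.2 ⟨a, by simpa using hE.refl a⟩
  have h2 : (Finset.univ.filter fun b => S.quotientGraph.src b = S.quotientGraph.src a).card ≤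
      (Finset.univ.filter fun b => f.SameGate a b).card :=
    Finset.card_le_card fun b hb => by simpa using h a b rfl (by simpa using hb)
  have := hgate a
  omega

end MarkedGraph.Simplex
end OuterSpace

theorem mainTheorem12 {N : ℕ} (hN : 2 ≤ N) (T : OuterSpace.FNTree.{w} N)
    (Γ : OuterSpace.MarkedGraph.{u} N) :
    (∃ T₀ : Γ.Simplex, T₀.IsMinimizer T) ∧
    ∀ T₀ : Γ.Simplex, T₀.IsMinimizer T →
      ∀ f : T₀.DiffOfMarkings T, f.IsOptimal →
        ∃ τ : OuterSpace.TrainTrack T₀.quotientGraph, f.Induces τ ∧ τ.IsRecurrent := by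
  have hN : N ≠ 0 := by omega
  refine ⟨OuterSpace.MarkedGraph.Simplex.exists_isMinimizer hN Γ T, fun S hS f hf => ?_⟩
  have := Fintype.ofFinite S.quotientGraph.Edge
  have hle := hS.maxSlope_le_volume hN hf
  have hlen := f.length_eq_of_maxSlope_le (hle _)
  have hpos : ∀ e : S.quotientGraph.Edge, 0 < f.toEquivariantMap.length e.1 := fun e => by
    rw [hlen]
    exact mul_pos (OuterSpace.MarkedGraph.Simplex.maxSlope_pos hN f) e.2
  have hE := f.sameGate_equivalence hpos
  have hgate := f.two_mul_card_gate_le hpos fun φ => f.volume_le_maxSlope.trans (hle φ)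
  obtain ⟨e, he⟩ := S.exists_len_pos
  have : Nonempty S.quotientGraph.Edge := ⟨⟨e, he⟩⟩
  let τ : OuterSpace.TrainTrack S.quotientGraph :=
    { rel := f.SameGate
      src_eq := fun _ _ => f.src_eq_of_sameGate
      equivalence := hE
      two_gates := OuterSpace.MarkedGraph.Simplex.exists_not_sameGate hN f hE hgate }
  refine ⟨τ, ⟨Set.eq_univ_of_forall fun e d hd => ?_, fun _ _ => Iff.rfl⟩,
    τ.isRecurrent_of_two_mul_card_gate_le S.quotientGraph_connected hgate⟩
  rw [f.slope_eq, hlen, hd, mul_div_cancel_right₀ _ e.2.ne']
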